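/- **Theorem 5.5 (Littlewood's Theorem).** Let $\mathbb{BC}=\{z+jw : z,w\in\mathbb C(i)\}$ ($ij=ji$, $i^2=j^2=-1$) be the ring of bicomplex numbers, $e_1=\frac{1+ij}2$, $e_2=\frac{1-ij}2$, so that every $Z=z+jw$ is uniquely $Z=z_1e_1+z_2e_2$ with $z_1=z-iw$, $z_2=z+iw$ in $\mathbb C(i)$. Let $\mathbb D=\{s e_1+t e_2 : s,t\in\mathbb R\}$ be the hyperbolic numbers, partially ordered by comparing both components $s,t$, with division and the square root of nonnegative elements taken componentwise, and let $|Z|_k=|z_1|e_1+|z_2|e_2\in\mathbb D$. Let $\mathbb D_{\mathbb{BC}}=\{z_1e_1+z_2e_2 : |z_1|<1,\ |z_2|<1\}$ be the unit discus. A function $F:\mathbb D_{\mathbb{BC}}\to\mathbb{BC}$ is bicomplex holomorphic if $F(z+jw)=e_1F_1(z-iw)+e_2F_2(z+iw)$ with $F_1,F_2$ complex holomorphic on the open unit disk of $\mathbb C$. Let $H^2(\mathbb D_{\mathbb{BC}})$ be the $\mathbb{BC}$-module of holomorphic $f(Z)=\sum_{n\ge0}a_nZ^n$ on $\mathbb D_{\mathbb{BC}}$,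 $a_n\in\mathbb{BC}$, for which $\sum_n|a_n|_k^2$ converges, with the hyperbolic-valued norm $\|f\|_{\mathbb D}=\bigl(\sum_n|a_n|_k^2\bigr)^{1/2}$. A $\mathbb{BC}$-linear operator $T$ on $H^2(\mathbb D_{\mathbb{BC}})$ is bounded if there is a nonnegative $M\in\mathbb D$ with $\|Tf\|_{\mathbb D}\le M\|f\|_{\mathbb D}$ for all $f$, and then $\|T\|_{\mathbb D}=\sup\{\|Tf\|_{\mathbb D} : \|f\|_{\mathbb D}\le1\}$, the least upper bound in $\mathbb D$. Let $\Phi:\mathbb D_{\mathbb{BC}}\to\mathbb D_{\mathbb{BC}}$ be bicomplex holomorphic. Then the composition operator $C_\Phi f=f\circ\Phi$ maps $H^2(\mathbb D_{\mathbb{BC}})$ into itself, is bounded on $H^2(\mathbb D_{\mathbb{BC}})$, and $$\|C_\Phi\|_{\mathbb D}\le\sqrt{\frac{1+|\Phi(0)|_k}{1-|\Phi(0)|_k}}\quad\text{in }\mathbb D.$$ -/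

import Mathlib

/-! ### Bicomplex numbers -/

/-- A bicomplex number `Z = z + j w` with `z, w ∈ ℂ(i)`. -/
@[ext]
structure Bicomplex where
  z : ℂ
  w : ℂ

namespace Bicomplex

instance : Zero Bicomplex := ⟨⟨0, 0⟩⟩
instance : One Bicomplex := ⟨⟨1, 0⟩⟩
instance : Add Bicomplex := ⟨fun Z U => ⟨Z.z + U.z, Z.w + U.w⟩⟩
instance : Neg Bicomplex := ⟨fun Z => ⟨-Z.z, -Z.w⟩⟩
instance : Sub Bicomplex := ⟨fun Z U => ⟨Z.z - U.z, Z.w - U.w⟩⟩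
/-- `(z + j w) (u + j v) = (z u - w v) + j (w u + z v)`, i.e. `j ^ 2 = -1`. -/
instance : Mul Bicomplex := ⟨fun Z U => ⟨Z.z * U.z - Z.w * U.w, Z.w * U.z + Z.z * U.w⟩⟩

@[simp] theorem zero_z : (0 : Bicomplex).z = 0 := rfl
@[simp] theorem zero_w : (0 : Bicomplex).w = 0 := rfl
@[simp] theorem one_z : (1 : Bicomplex).z = 1 := rfl
@[simp] theorem one_w : (1 : Bicomplex).w = 0 := rfl
@[simp] theorem add_z (Z U : Bicomplex) : (Z + U).z = Z.z + U.z := rfl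
@[simp] theorem add_w (Z U : Bicomplex) : (Z + U).w = Z.w + U.w := rfl
@[simp] theorem neg_z (Z : Bicomplex) : (-Z).z = -Z.z := rfl
@[simp] theorem neg_w (Z : Bicomplex) : (-Z).w = -Z.w := rfl
@[simp] theorem sub_z (Z U : Bicomplex) : (Z - U).z = Z.z - U.z := rfl
@[simp] theorem sub_w (Z U : Bicomplex) : (Z - U).w = Z.w - U.w := rfl
@[simp] theorem mul_z (Z U : Bicomplex) : (Z * U).z = Z.z * U.z - Z.w * U.w := rfl
@[simp] theorem mul_w (Z U : Bicomplex) : (Z * U).w = Z.w * U.z + Z.z * U.w := rfl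

instance : CommRing Bicomplex where
  add_assoc _ _ _ := by ext <;> simp <;> ring
  zero_add _ := by ext <;> simp
  add_zero _ := by ext <;> simp
  add_comm _ _ := by ext <;> simp <;> ring
  neg_add_cancel _ := by ext <;> simp
  sub_eq_add_neg _ _ := by ext <;> simp <;> ring
  mul_assoc _ _ _ := by ext <;> simp <;> ring
  one_mul _ := by ext <;> simp
  mul_one _ := by ext <;> simp
  mul_comm _ _ := by ext <;> simp <;> ring
  left_distrib _ _ _ := by ext <;> simp <;> ring
  right_distrib _ _ _ := by ext <;> simp <;> ring
  zero_mul _ := by ext <;> simp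
  mul_zero _ := by ext <;> simp
  nsmul := nsmulRec
  zsmul := zsmulRec

/-- The inclusion `ℂ(i) → 𝔹ℂ`. -/
def ofComplex (z : ℂ) : Bicomplex := ⟨z, 0⟩

/-- The idempotent `e₁ = (1 + i j) / 2`. -/
noncomputable def e₁ : Bicomplex := ⟨1 / 2, Complex.I / 2⟩

/-- The idempotent `e₂ = (1 - i j) / 2`. -/
noncomputable def e₂ : Bicomplex := ⟨1 / 2, -(Complex.I / 2)⟩

/-- The first idempotent component `z₁ = z - i w` of `Z = z + j w`. -/
noncomputable def idem₁ (Z : Bicomplex) : ℂ := Z.z - Complex.I * Z.w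

/-- The second idempotent component `z₂ = z + i w` of `Z = z + j w`. -/
noncomputable def idem₂ (Z : Bicomplex) : ℂ := Z.z + Complex.I * Z.w

/-- The conjugation `(z + j w)^{†₃} = z̄ - j w̄`. -/
def dagger₃ (Z : Bicomplex) : Bicomplex :=
  ⟨(starRingEnd ℂ) Z.z, -(starRingEnd ℂ) Z.w⟩

/-- The idempotent representation `Z = z₁ e₁ + z₂ e₂`. -/
theorem idempotent_representation (Z : Bicomplex) :
    Z = ofComplex Z.idem₁ * e₁ + ofComplex Z.idem₂ * e₂ := by
  ext
  · simp [ofComplex, e₁, e₂, idem₁, idem₂]; ring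
  · simp [ofComplex, e₁, e₂, idem₁, idem₂]; linear_combination Z.w * Complex.I_sq

/-- The first idempotent component as a ring homomorphism. -/
noncomputable def idemHom₁ : Bicomplex →+* ℂ where
  toFun := idem₁
  map_zero' := by simp [idem₁]
  map_one' := by simp [idem₁]
  map_add' _ _ := by simp [idem₁]; ring
  map_mul' Z U := by simp [idem₁]; linear_combination (-Z.w * U.w) * Complex.I_sq

/-- The second idempotent component as a ring homomorphism. -/
noncomputable def idemHom₂ : Bicomplex →+* ℂ where
  toFun := idem₂
  map_zero' := by simp [idem₂]
  map_one' := by simp [idem₂]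
  map_add' _ _ := by simp [idem₂]; ring
  map_mul' Z U := by simp [idem₂]; linear_combination (-Z.w * U.w) * Complex.I_sq

@[simp] theorem idem₁_zero : (0 : Bicomplex).idem₁ = 0 := map_zero idemHom₁
@[simp] theorem idem₂_zero : (0 : Bicomplex).idem₂ = 0 := map_zero idemHom₂
theorem idem₁_add (Z U : Bicomplex) : (Z + U).idem₁ = Z.idem₁ + U.idem₁ := map_add idemHom₁ Z U
theorem idem₂_add (Z U : Bicomplex) : (Z + U).idem₂ = Z.idem₂ + U.idem₂ := map_add idemHom₂ Z U
theorem idem₁_mul (Z U : Bicomplex) : (Z * U).idem₁ = Z.idem₁ * U.idem₁ := map_mul idemHom₁ Z U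
theorem idem₂_mul (Z U : Bicomplex) : (Z * U).idem₂ = Z.idem₂ * U.idem₂ := map_mul idemHom₂ Z U
theorem idem₁_pow (Z : Bicomplex) (n : ℕ) : (Z ^ n).idem₁ = Z.idem₁ ^ n := map_pow idemHom₁ Z n
theorem idem₂_pow (Z : Bicomplex) (n : ℕ) : (Z ^ n).idem₂ = Z.idem₂ ^ n := map_pow idemHom₂ Z n

theorem ext_idem {Z U : Bicomplex} (h₁ : Z.idem₁ = U.idem₁) (h₂ : Z.idem₂ = U.idem₂) : Z = U := by
  rw [idempotent_representation Z, idempotent_representation U, h₁, h₂]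

theorem idem₁_combo (a b : ℂ) : (ofComplex a * e₁ + ofComplex b * e₂).idem₁ = a := by
  simp [ofComplex, e₁, e₂, idem₁]; linear_combination ((b - a) / 2) * Complex.I_sq

theorem idem₂_combo (a b : ℂ) : (ofComplex a * e₁ + ofComplex b * e₂).idem₂ = b := by
  simp [ofComplex, e₁, e₂, idem₂]; linear_combination ((a - b) / 2) * Complex.I_sq

/-- The Euclidean topology of `𝔹ℂ ≅ ℂ²`. -/
noncomputable instance : TopologicalSpace Bicomplex :=
  TopologicalSpace.induced (fun Z => (Z.z, Z.w)) inferInstance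

theorem continuous_pair : Continuous (fun Z : Bicomplex => (Z.z, Z.w)) := continuous_induced_dom
theorem continuous_z : Continuous Bicomplex.z := continuous_fst.comp continuous_pair
theorem continuous_w : Continuous Bicomplex.w := continuous_snd.comp continuous_pair
theorem continuous_idem₁ : Continuous idem₁ :=
  continuous_z.sub (continuous_const.mul continuous_w)
theorem continuous_idem₂ : Continuous idem₂ :=
  continuous_z.add (continuous_const.mul continuous_w)

instance : ContinuousAdd Bicomplex where
  continuous_add := by
    refine continuous_induced_rng.2 (Continuous.prodMk ?_ ?_)
    · exact (continuous_z.comp continuous_fst).add (continuous_z.comp continuous_snd)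
    · exact (continuous_w.comp continuous_fst).add (continuous_w.comp continuous_snd)

instance : ContinuousMul Bicomplex where
  continuous_mul := by
    have h₁ := continuous_z.comp (continuous_fst (X := Bicomplex) (Y := Bicomplex))
    have h₂ := continuous_z.comp (continuous_snd (X := Bicomplex) (Y := Bicomplex))
    have h₃ := continuous_w.comp (continuous_fst (X := Bicomplex) (Y := Bicomplex))
    have h₄ := continuous_w.comp (continuous_snd (X := Bicomplex) (Y := Bicomplex))
    refine continuous_induced_rng.2 (Continuous.prodMk ?_ ?_)
    · exact (h₁.mul h₂).sub (h₃.mul h₄)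
    · exact (h₃.mul h₂).add (h₁.mul h₄)

instance : IsTopologicalSemiring Bicomplex where

end Bicomplex

/-! ### Hyperbolic numbers -/

/-- A hyperbolic number `x + y k` with `x, y ∈ ℝ` and `k ^ 2 = 1`. -/
@[ext]
structure Hyperbolic where
  x : ℝ
  y : ℝ

namespace Hyperbolic

instance : Zero Hyperbolic := ⟨⟨0, 0⟩⟩
instance : One Hyperbolic := ⟨⟨1, 0⟩⟩
instance : Add Hyperbolic := ⟨fun a b => ⟨a.x + b.x, a.y + b.y⟩⟩
instance : Neg Hyperbolic := ⟨fun a => ⟨-a.x, -a.y⟩⟩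
instance : Sub Hyperbolic := ⟨fun a b => ⟨a.x - b.x, a.y - b.y⟩⟩
instance : Mul Hyperbolic := ⟨fun a b => ⟨a.x * b.x + a.y * b.y, a.x * b.y + a.y * b.x⟩⟩

@[simp] theorem zero_x : (0 : Hyperbolic).x = 0 := rfl
@[simp] theorem zero_y : (0 : Hyperbolic).y = 0 := rfl
@[simp] theorem one_x : (1 : Hyperbolic).x = 1 := rfl
@[simp] theorem one_y : (1 : Hyperbolic).y = 0 := rfl
@[simp] theorem add_x (a b : Hyperbolic) : (a + b).x = a.x + b.x := rfl
@[simp] theorem add_y (a b : Hyperbolic) : (a + b).y = a.y + b.y := rfl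
@[simp] theorem neg_x (a : Hyperbolic) : (-a).x = -a.x := rfl
@[simp] theorem neg_y (a : Hyperbolic) : (-a).y = -a.y := rfl
@[simp] theorem sub_x (a b : Hyperbolic) : (a - b).x = a.x - b.x := rfl
@[simp] theorem sub_y (a b : Hyperbolic) : (a - b).y = a.y - b.y := rfl
@[simp] theorem mul_x (a b : Hyperbolic) : (a * b).x = a.x * b.x + a.y * b.y := rfl
@[simp] theorem mul_y (a b : Hyperbolic) : (a * b).y = a.x * b.y + a.y * b.x := rfl

instance : CommRing Hyperbolic where
  add_assoc _ _ _ := by ext <;> simp <;> ring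
  zero_add _ := by ext <;> simp
  add_zero _ := by ext <;> simp
  add_comm _ _ := by ext <;> simp <;> ring
  neg_add_cancel _ := by ext <;> simp
  sub_eq_add_neg _ _ := by ext <;> simp <;> ring
  mul_assoc _ _ _ := by ext <;> simp <;> ring
  one_mul _ := by ext <;> simp
  mul_one _ := by ext <;> simp
  mul_comm _ _ := by ext <;> simp <;> ring
  left_distrib _ _ _ := by ext <;> simp <;> ring
  right_distrib _ _ _ := by ext <;> simp <;> ring
  zero_mul _ := by ext <;> simp
  mul_zero _ := by ext <;> simp
  nsmul := nsmulRec
  zsmul := zsmulRec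

/-- The inclusion `𝔻 → 𝔹ℂ`, with `k = i j`. -/
noncomputable def toBicomplex (a : Hyperbolic) : Bicomplex := ⟨(a.x : ℂ), Complex.I * (a.y : ℂ)⟩

/-- The `e₁`-component `x + y` of `x + y k = (x + y) e₁ + (x - y) e₂`. -/
def idem₁ (a : Hyperbolic) : ℝ := a.x + a.y

/-- The `e₂`-component `x - y` of `x + y k = (x + y) e₁ + (x - y) e₂`. -/
def idem₂ (a : Hyperbolic) : ℝ := a.x - a.y

/-- The hyperbolic number `s e₁ + t e₂`. -/
noncomputable def ofIdem (s t : ℝ) : Hyperbolic := ⟨(s + t) / 2, (s - t) / 2⟩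

@[simp] theorem idem₁_ofIdem (s t : ℝ) : (ofIdem s t).idem₁ = s := by simp [idem₁, ofIdem]; ring
@[simp] theorem idem₂_ofIdem (s t : ℝ) : (ofIdem s t).idem₂ = t := by simp [idem₂, ofIdem]; ring

theorem ext_idem {a b : Hyperbolic} (h₁ : a.idem₁ = b.idem₁) (h₂ : a.idem₂ = b.idem₂) : a = b := by
  simp only [idem₁, idem₂] at h₁ h₂
  ext <;> linarith

theorem ofIdem_toBicomplex (s t : ℝ) : (ofIdem s t).toBicomplex =
    Bicomplex.ofComplex s * Bicomplex.e₁ + Bicomplex.ofComplex t * Bicomplex.e₂ := by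
  ext <;> simp [ofIdem, toBicomplex, Bicomplex.ofComplex, Bicomplex.e₁, Bicomplex.e₂] <;> ring

theorem idem₁_add (a b : Hyperbolic) : (a + b).idem₁ = a.idem₁ + b.idem₁ := by
  simp [idem₁]; ring
theorem idem₂_add (a b : Hyperbolic) : (a + b).idem₂ = a.idem₂ + b.idem₂ := by
  simp [idem₂]; ring
theorem idem₁_mul (a b : Hyperbolic) : (a * b).idem₁ = a.idem₁ * b.idem₁ := by
  simp [idem₁]; ring
theorem idem₂_mul (a b : Hyperbolic) : (a * b).idem₂ = a.idem₂ * b.idem₂ := by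
  simp [idem₂]; ring

/-- The partial order of `𝔻`: `a ≤ b` iff both idempotent components of `b - a` are
nonnegative. -/
instance : PartialOrder Hyperbolic where
  le a b := a.idem₁ ≤ b.idem₁ ∧ a.idem₂ ≤ b.idem₂
  le_refl _ := ⟨le_rfl, le_rfl⟩
  le_trans _ _ _ h h' := ⟨h.1.trans h'.1, h.2.trans h'.2⟩
  le_antisymm _ _ h h' := ext_idem (le_antisymm h.1 h'.1) (le_antisymm h.2 h'.2)

theorem le_def (a b : Hyperbolic) : a ≤ b ↔ a.idem₁ ≤ b.idem₁ ∧ a.idem₂ ≤ b.idem₂ := Iff.rfl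

/-- The Euclidean topology of `𝔻 ≅ ℝ²`. -/
noncomputable instance : TopologicalSpace Hyperbolic :=
  TopologicalSpace.induced (fun a => (a.x, a.y)) inferInstance

/-- The nonnegative square root of a nonnegative hyperbolic number. -/
noncomputable def sqrt (a : Hyperbolic) : Hyperbolic :=
  ofIdem (Real.sqrt a.idem₁) (Real.sqrt a.idem₂)

theorem sqrt_mul_self {a : Hyperbolic} (h : 0 ≤ a) : 0 ≤ sqrt a ∧ sqrt a * sqrt a = a := by
  have h' : 0 ≤ a.idem₁ ∧ 0 ≤ a.idem₂ := by simpa [le_def, idem₁, idem₂] using h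
  refine ⟨⟨?_, ?_⟩, ext_idem ?_ ?_⟩
  · simp [sqrt]; simp [idem₁]
  · simp [sqrt]; simp [idem₂]
  · simp [sqrt, idem₁_mul, Real.mul_self_sqrt h'.1]
  · simp [sqrt, idem₂_mul, Real.mul_self_sqrt h'.2]

/-- The quotient `a / b`; it is meaningful when both idempotent components of `b` are nonzero,
that is, when `b` is invertible. -/
noncomputable instance : Div Hyperbolic :=
  ⟨fun a b => ofIdem (a.idem₁ / b.idem₁) (a.idem₂ / b.idem₂)⟩

theorem div_mul_cancel_of_isUnit (a : Hyperbolic) {b : Hyperbolic} (hb : IsUnit b) :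
    a / b * b = a := by
  obtain ⟨c, hc⟩ := hb.exists_right_inv
  have e₁ : b.idem₁ * c.idem₁ = 1 := by rw [← idem₁_mul, hc]; simp [idem₁]
  have e₂ : b.idem₂ * c.idem₂ = 1 := by rw [← idem₂_mul, hc]; simp [idem₂]
  refine ext_idem ?_ ?_
  · rw [idem₁_mul]
    exact (congrArg (· * b.idem₁) (idem₁_ofIdem _ _)).trans
      (div_mul_cancel₀ _ (left_ne_zero_of_mul_eq_one e₁))
  · rw [idem₂_mul]
    exact (congrArg (· * b.idem₂) (idem₂_ofIdem _ _)).trans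
      (div_mul_cancel₀ _ (left_ne_zero_of_mul_eq_one e₂))

/-- The supremum in `𝔻`, computed on the idempotent components. -/
noncomputable instance : SupSet Hyperbolic :=
  ⟨fun S => ofIdem (sSup (idem₁ '' S)) (sSup (idem₂ '' S))⟩

/-- `sSup S` is the least upper bound whenever `S` is nonempty and bounded above. -/
theorem isLUB_sSup {S : Set Hyperbolic} (hne : S.Nonempty) (hb : BddAbove S) :
    IsLUB S (sSup S) := by
  obtain ⟨M, hM⟩ := hb
  have l₁ : IsLUB (idem₁ '' S) (sSup (idem₁ '' S)) := Real.isLUB_sSup (hne.image _)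
    ⟨M.idem₁, by rintro _ ⟨a, ha, rfl⟩; exact (hM ha).1⟩
  have l₂ : IsLUB (idem₂ '' S) (sSup (idem₂ '' S)) := Real.isLUB_sSup (hne.image _)
    ⟨M.idem₂, by rintro _ ⟨a, ha, rfl⟩; exact (hM ha).2⟩
  refine ⟨fun a ha => ⟨?_, ?_⟩, fun u hu => ⟨?_, ?_⟩⟩
  · exact (l₁.1 ⟨a, ha, rfl⟩).trans_eq (idem₁_ofIdem _ _).symm
  · exact (l₂.1 ⟨a, ha, rfl⟩).trans_eq (idem₂_ofIdem _ _).symm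
  · refine (idem₁_ofIdem _ _).trans_le (l₁.2 ?_)
    rintro _ ⟨a, ha, rfl⟩; exact (hu ha).1
  · refine (idem₂_ofIdem _ _).trans_le (l₂.2 ?_)
    rintro _ ⟨a, ha, rfl⟩; exact (hu ha).2

/-- Summability in `𝔻` is summability of both idempotent components. -/
theorem summable_iff (f : ℕ → Hyperbolic) :
    Summable f ↔ Summable (fun n => (f n).idem₁) ∧ Summable (fun n => (f n).idem₂) := by
  let g : Hyperbolic →+ ℝ × ℝ :=
    { toFun := fun a => (a.x, a.y), map_zero' := rfl, map_add' := fun _ _ => rfl }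
  have hg : Topology.IsInducing g := ⟨rfl⟩
  have key : Summable f ↔ Summable (fun n => (f n).x) ∧ Summable (fun n => (f n).y) := by
    constructor
    · rintro ⟨a, ha⟩
      have h := (hg.hasSum_iff f a).2 ha
      exact ⟨⟨a.x, (continuous_fst.tendsto _).comp h |>.congr (fun s => by simp [g, Prod.fst_sum])⟩,
        ⟨a.y, (continuous_snd.tendsto _).comp h |>.congr (fun s => by simp [g, Prod.snd_sum])⟩⟩
    · rintro ⟨⟨a, ha⟩, ⟨b, hb⟩⟩
      exact ⟨⟨a, b⟩, (hg.hasSum_iff f ⟨a, b⟩).1 (ha.prodMk hb)⟩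
  rw [key]
  constructor
  · rintro ⟨h, h'⟩
    exact ⟨h.add h', h.sub h'⟩
  · rintro ⟨h, h'⟩
    refine ⟨((h.add h').div_const 2).congr fun n => ?_, ((h.sub h').div_const 2).congr fun n => ?_⟩
    · simp only [idem₁, idem₂]; ring
    · simp only [idem₁, idem₂]; ring

end Hyperbolic

namespace Bicomplex

/-- The hyperbolic modulus `|Z|_k = |z₁| e₁ + |z₂| e₂`. -/
noncomputable def hypAbs (Z : Bicomplex) : Hyperbolic := Hyperbolic.ofIdem ‖Z.idem₁‖ ‖Z.idem₂‖

/-- `|Z|_k ^ 2 = Z · Z^{†₃}`. -/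
theorem hypAbs_sq (Z : Bicomplex) : (Z.hypAbs ^ 2).toBicomplex = Z * Z.dagger₃ := by
  have h : Z.hypAbs ^ 2 = Hyperbolic.ofIdem (‖Z.idem₁‖ ^ 2) (‖Z.idem₂‖ ^ 2) := by
    refine Hyperbolic.ext_idem ?_ ?_
    · simp [hypAbs, sq, Hyperbolic.idem₁_mul]
    · simp [hypAbs, sq, Hyperbolic.idem₂_mul]
  rw [h, Hyperbolic.ofIdem_toBicomplex]
  push_cast
  rw [← Complex.mul_conj', ← Complex.mul_conj']
  refine ext_idem ?_ ?_
  · rw [idem₁_combo, idem₁_mul]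
    simp [idem₁, dagger₃]
  · rw [idem₂_combo, idem₂_mul]
    simp [idem₂, dagger₃]

end Bicomplex

/-! ### The unit discus, holomorphic functions and the Hardy space -/

/-- The unit discus `𝔻_𝔹ℂ = {e₁ z₁ + e₂ z₂ : |z₁| < 1, |z₂| < 1}`. -/
def unitDiscus : Set Bicomplex := {Z | ‖Z.idem₁‖ < 1 ∧ ‖Z.idem₂‖ < 1}

instance : Zero unitDiscus := ⟨⟨0, by simp [unitDiscus]⟩⟩

/-- `F : U → 𝔹ℂ` is bicomplex holomorphic: there are complex holomorphic functions `F₁`, `F₂` on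
the idempotent projections `U₁`, `U₂` of `U` with
`F (z + j w) = e₁ F₁ (z - i w) + e₂ F₂ (z + i w)` on `U`. -/
def BicomplexHolomorphic {U : Set Bicomplex} (F : U → Bicomplex) : Prop :=
  ∃ F₁ F₂ : ℂ → ℂ,
    DifferentiableOn ℂ F₁ (Bicomplex.idem₁ '' U) ∧
    DifferentiableOn ℂ F₂ (Bicomplex.idem₂ '' U) ∧
    ∀ Z : U, F Z = Bicomplex.ofComplex (F₁ (Z : Bicomplex).idem₁) * Bicomplex.e₁ +
      Bicomplex.ofComplex (F₂ (Z : Bicomplex).idem₂) * Bicomplex.e₂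

/-- `f (Z) = ∑ aₙ Zⁿ` on the unit discus. -/
def HasBicomplexPowerSeries (f : unitDiscus → Bicomplex) (a : ℕ → Bicomplex) : Prop :=
  ∀ Z : unitDiscus, HasSum (fun n => a n * (Z : Bicomplex) ^ n) (f Z)

/-- A complex power series on the unit disc determines its coefficients. -/
theorem complex_coeff_unique {a b : ℕ → ℂ} {f : ℂ → ℂ}
    (ha : ∀ z : ℂ, ‖z‖ < 1 → HasSum (fun n => a n * z ^ n) (f z))
    (hb : ∀ z : ℂ, ‖z‖ < 1 → HasSum (fun n => b n * z ^ n) (f z)) : a = b := by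
  have key : ∀ c : ℕ → ℂ, (∀ z : ℂ, ‖z‖ < 1 → HasSum (fun n => c n * z ^ n) (f z)) →
      HasFPowerSeriesAt f (FormalMultilinearSeries.ofScalars ℂ c) 0 := by
    intro c hc
    rw [hasFPowerSeriesAt_iff]
    filter_upwards [Metric.ball_mem_nhds (0 : ℂ) one_pos] with z hz
    simpa [FormalMultilinearSeries.coeff_ofScalars, mul_comm] using hc z (by simpa using hz)
  have h := (key a ha).eq_formalMultilinearSeries (key b hb)
  funext n
  have := congrArg (fun p => FormalMultilinearSeries.coeff p n) h
  simpa [FormalMultilinearSeries.coeff_ofScalars] using this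

/-- A bicomplex power series on the unit discus determines its coefficients. -/
theorem HasBicomplexPowerSeries.unique {f : unitDiscus → Bicomplex} {a b : ℕ → Bicomplex}
    (ha : HasBicomplexPowerSeries f a) (hb : HasBicomplexPowerSeries f b) : a = b := by
  let P : ℂ → Bicomplex := fun z => Bicomplex.ofComplex z * Bicomplex.e₁ +
    Bicomplex.ofComplex z * Bicomplex.e₂
  have hP : ∀ z : ℂ, ‖z‖ < 1 → P z ∈ unitDiscus := fun z hz =>
    ⟨by rwa [Bicomplex.idem₁_combo], by rwa [Bicomplex.idem₂_combo]⟩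
  classical
  let g : ℂ → Bicomplex := fun z => if h : ‖z‖ < 1 then f ⟨P z, hP z h⟩ else 0
  have k₁ : ∀ c, HasBicomplexPowerSeries f c → ∀ z : ℂ, ‖z‖ < 1 →
      HasSum (fun n => (c n).idem₁ * z ^ n) (g z).idem₁ := by
    intro c hc z hz
    have h := (hc ⟨P z, hP z hz⟩).map Bicomplex.idemHom₁ Bicomplex.continuous_idem₁
    have e : ∀ n, Bicomplex.idemHom₁ (c n * P z ^ n) = (c n).idem₁ * z ^ n := fun n => by
      rw [map_mul, map_pow]
      exact congrArg (fun t => (c n).idem₁ * t ^ n) (Bicomplex.idem₁_combo z z)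
    have e' : g z = f ⟨P z, hP z hz⟩ := dif_pos hz
    rw [e']
    exact h.congr_fun fun n => (e n).symm
  have k₂ : ∀ c, HasBicomplexPowerSeries f c → ∀ z : ℂ, ‖z‖ < 1 →
      HasSum (fun n => (c n).idem₂ * z ^ n) (g z).idem₂ := by
    intro c hc z hz
    have h := (hc ⟨P z, hP z hz⟩).map Bicomplex.idemHom₂ Bicomplex.continuous_idem₂
    have e : ∀ n, Bicomplex.idemHom₂ (c n * P z ^ n) = (c n).idem₂ * z ^ n := fun n => by
      rw [map_mul, map_pow]
      exact congrArg (fun t => (c n).idem₂ * t ^ n) (Bicomplex.idem₂_combo z z)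
    have e' : g z = f ⟨P z, hP z hz⟩ := dif_pos hz
    rw [e']
    exact h.congr_fun fun n => (e n).symm
  have h₁ := complex_coeff_unique (k₁ a ha) (k₁ b hb)
  have h₂ := complex_coeff_unique (k₂ a ha) (k₂ b hb)
  funext n
  exact Bicomplex.ext_idem (congrFun h₁ n) (congrFun h₂ n)

open Classical in
/-- The coefficients of the power series of `f` on the unit discus (`0` if there is none). -/
noncomputable def bicomplexCoeff (f : unitDiscus → Bicomplex) : ℕ → Bicomplex :=
  if h : ∃ a, HasBicomplexPowerSeries f a then h.choose else 0

theorem HasBicomplexPowerSeries.coeff_eq {f : unitDiscus → Bicomplex} {a : ℕ → Bicomplex}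
    (ha : HasBicomplexPowerSeries f a) : bicomplexCoeff f = a := by
  have h : ∃ a, HasBicomplexPowerSeries f a := ⟨a, ha⟩
  rw [bicomplexCoeff, dif_pos h]
  exact h.choose_spec.unique ha

theorem summable_norm_sq_add {a b : ℕ → ℂ} (ha : Summable fun n => ‖a n‖ ^ 2)
    (hb : Summable fun n => ‖b n‖ ^ 2) : Summable fun n => ‖a n + b n‖ ^ 2 := by
  refine Summable.of_nonneg_of_le (fun n => by positivity) (fun n => ?_)
    ((ha.add hb).mul_left 2)
  have h := norm_add_le (a n) (b n)
  nlinarith [sq_nonneg (‖a n‖ - ‖b n‖), norm_nonneg (a n + b n)]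

theorem summable_hypAbs_sq_iff (a : ℕ → Bicomplex) :
    Summable (fun n => (a n).hypAbs ^ 2) ↔
      Summable (fun n => ‖(a n).idem₁‖ ^ 2) ∧ Summable (fun n => ‖(a n).idem₂‖ ^ 2) := by
  rw [Hyperbolic.summable_iff]
  simp [Bicomplex.hypAbs, sq, Hyperbolic.idem₁_mul, Hyperbolic.idem₂_mul]

/-- The bicomplex Hardy space `H²(𝔻_𝔹ℂ)`: the `𝔹ℂ`-module of the holomorphic functions
`f (Z) = ∑ aₙ Zⁿ` on the unit discus for which `∑ |aₙ|_k ^ 2` converges. -/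
def hardySpace : Submodule Bicomplex (unitDiscus → Bicomplex) where
  carrier := {f | BicomplexHolomorphic f ∧ ∃ a : ℕ → Bicomplex,
    HasBicomplexPowerSeries f a ∧ Summable (fun n => (a n).hypAbs ^ 2)}
  zero_mem' := by
    refine ⟨⟨0, 0, differentiableOn_const 0, differentiableOn_const 0, fun Z => ?_⟩, 0,
      fun Z => ?_, ?_⟩
    · ext <;> simp [Bicomplex.ofComplex]
    · simp [hasSum_zero]
    · rw [summable_hypAbs_sq_iff]
      simp
  add_mem' := by
    rintro f g ⟨⟨F₁, F₂, hF₁, hF₂, hF⟩, a, ha, hsa⟩ ⟨⟨G₁, G₂, hG₁, hG₂, hG⟩, b, hb, hsb⟩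
    refine ⟨⟨fun z => F₁ z + G₁ z, fun z => F₂ z + G₂ z, hF₁.add hG₁, hF₂.add hG₂, fun Z => ?_⟩,
      fun n => a n + b n, fun Z => ?_, ?_⟩
    · rw [Pi.add_apply, hF, hG]
      ext <;> simp [Bicomplex.ofComplex] <;> ring
    · simpa [add_mul] using (ha Z).add (hb Z)
    · rw [summable_hypAbs_sq_iff] at hsa hsb ⊢
      simp only [Bicomplex.idem₁_add, Bicomplex.idem₂_add]
      exact ⟨summable_norm_sq_add hsa.1 hsb.1, summable_norm_sq_add hsa.2 hsb.2⟩
  smul_mem' := by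
    rintro c f ⟨⟨F₁, F₂, hF₁, hF₂, hF⟩, a, ha, hsa⟩
    refine ⟨⟨fun z => c.idem₁ * F₁ z, fun z => c.idem₂ * F₂ z, hF₁.const_mul _, hF₂.const_mul _,
      fun Z => ?_⟩, fun n => c * a n, fun Z => ?_, ?_⟩
    · rw [Pi.smul_apply, hF, smul_eq_mul]
      refine Bicomplex.ext_idem ?_ ?_
      · rw [Bicomplex.idem₁_mul, Bicomplex.idem₁_combo, Bicomplex.idem₁_combo]
      · rw [Bicomplex.idem₂_mul, Bicomplex.idem₂_combo, Bicomplex.idem₂_combo]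
    · simpa [mul_assoc] using (ha Z).mul_left c
    · rw [summable_hypAbs_sq_iff] at hsa ⊢
      simp only [Bicomplex.idem₁_mul, Bicomplex.idem₂_mul, norm_mul, mul_pow]
      exact ⟨hsa.1.mul_left _, hsa.2.mul_left _⟩

/-- The hyperbolic-valued norm `‖f‖_𝔻 = (∑ |aₙ|_k ^ 2) ^ (1/2)` of `f (Z) = ∑ aₙ Zⁿ` in the
bicomplex Hardy space. -/
noncomputable def hardyNorm (f : hardySpace) : Hyperbolic :=
  Hyperbolic.sqrt (∑' n, (bicomplexCoeff f.1 n).hypAbs ^ 2)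

/-! ### Operators on the Hardy space -/

/-- A `𝔹ℂ`-linear operator `T` on the Hardy space is bounded: there is a nonnegative hyperbolic
number `M` with `‖T f‖_𝔻 ≤ M ‖f‖_𝔻` for all `f`. -/
def HardyBounded (T : hardySpace →ₗ[Bicomplex] hardySpace) : Prop :=
  ∃ M : Hyperbolic, 0 ≤ M ∧ ∀ f : hardySpace, hardyNorm (T f) ≤ M * hardyNorm f

/-- The set `{‖T f‖_𝔻 : ‖f‖_𝔻 ≤ 1}`. -/
def hardyUnitBallNorms (T : hardySpace →ₗ[Bicomplex] hardySpace) : Set Hyperbolic :=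
  {N | ∃ f : hardySpace, hardyNorm f ≤ 1 ∧ N = hardyNorm (T f)}

/-- The hyperbolic-valued operator norm `‖T‖_𝔻 = sup {‖T f‖_𝔻 : ‖f‖_𝔻 ≤ 1}`. -/
noncomputable def hardyOpNorm (T : hardySpace →ₗ[Bicomplex] hardySpace) : Hyperbolic :=
  sSup (hardyUnitBallNorms T)

/-- The composition operator `C_Φ f = f ∘ Φ` on functions on the unit discus. -/
def compositionOperator (Φ : unitDiscus → unitDiscus) :
    (unitDiscus → Bicomplex) →ₗ[Bicomplex] (unitDiscus → Bicomplex) where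
  toFun f := f ∘ Φ
  map_add' _ _ := rfl
  map_smul' _ _ := rfl

/-! ### Littlewood's subordination principle on the complex unit disc -/

section ComplexLittlewood

open Metric Filter Topology Real

/-! Everything splits along the idempotents: the two components of $f\circ\Phi$ are $F_1\circ G_1$
and $F_2\circ G_2$, and norm, order, quotient and square root in $\mathbb D$ are componentwise. The
theorem thus amounts to two copies of the classical estimate
$\|f\circ\varphi\|^2\le\frac{1+|\varphi(0)|}{1-|\varphi(0)|}\|f\|^2$ in $H^2$ of the disc,
`littlewood_complex`.

That estimate comes from a harmonic majorant. For a polynomial $p$ with coefficients $a_n$ there is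
an entire $h$ with $|p|^2\le\operatorname{Re}h$ on the disc and $h(0)=\sum|a_n|^2$
(`exists_re_majorant_norm_sq`). On $|z|=r<1$ the mean of $|p\circ\varphi|^2$ is at most that of
$\operatorname{Re}(h\circ\varphi)$, which is $\operatorname{Re}h(\varphi(0))$ by the mean value
property. As $\operatorname{Re}h\ge0$, Harnack's inequality `re_le_of_re_nonneg` bounds this by
$\frac{1+|\varphi(0)|}{1-|\varphi(0)|}h(0)$. No separate reduction to $\varphi(0)=0$ by disc
automorphisms is needed.

Dominated convergence passes from polynomials to $f$. Parseval on $|z|=r$ then turns the bound on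
means into a bound on the Taylor coefficients of $f\circ\varphi$, and $r\to1$ concludes. -/

theorem sum_range_succ_mul_pow (a : ℕ → ℂ) (N : ℕ) (w : ℂ) :
    ∑ n ∈ Finset.range (N + 1), a n * w ^ n =
      a 0 + w * ∑ n ∈ Finset.range N, a (n + 1) * w ^ n := by
  rw [Finset.sum_range_succ', add_comm, Finset.mul_sum]
  congr 1
  · simp
  · exact Finset.sum_congr rfl fun n _ => by ring

theorem differentiable_sum_range_mul_pow (a : ℕ → ℂ) (N : ℕ) :
    Differentiable ℂ fun w : ℂ => ∑ n ∈ Finset.range N, a n * w ^ n := by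
  fun_prop

/-- With $p=c+wq$, where $q$ is the backward shift of $p$, this isolates the only term of $|p|^2$
that is not the real part of a holomorphic function. Both the majorant and Parseval's identity
follow by iterating it. -/
theorem norm_add_mul_sq (c w q : ℂ) :
    ‖c + w * q‖ ^ 2 = ‖c‖ ^ 2 + (2 * (starRingEnd ℂ c * (w * q))).re + ‖w‖ ^ 2 * ‖q‖ ^ 2 := by
  simp only [Complex.sq_norm, Complex.normSq_apply]
  simp
  ring

/-- The squared modulus of a polynomial is dominated on the unit disc by the real part of an entire
function whose value at `0` is the sum of the squared moduli of the coefficients. -/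
theorem exists_re_majorant_norm_sq (N : ℕ) (a : ℕ → ℂ) :
    ∃ h : ℂ → ℂ, Differentiable ℂ h ∧ h 0 = ((∑ n ∈ Finset.range N, ‖a n‖ ^ 2 : ℝ) : ℂ) ∧
      ∀ w : ℂ, ‖w‖ < 1 → ‖∑ n ∈ Finset.range N, a n * w ^ n‖ ^ 2 ≤ (h w).re := by
  induction N generalizing a with
  | zero => exact ⟨0, differentiable_const 0, by simp, by simp⟩
  | succ N ih =>
    obtain ⟨h, hd, h0, hle⟩ := ih fun n => a (n + 1)
    have hq := differentiable_sum_range_mul_pow (fun n => a (n + 1)) N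
    -- The recursion keeps the holomorphic terms of `norm_add_mul_sq` and replaces $|q|^2$ by its
    -- own majorant. The cross term vanishes at $0$.
    refine ⟨fun w => h w + ((‖a 0‖ ^ 2 : ℝ) : ℂ) +
      2 * (starRingEnd ℂ (a 0) * (w * ∑ n ∈ Finset.range N, a (n + 1) * w ^ n)), by fun_prop, ?_,
      fun w hw => ?_⟩
    · simp only [Finset.sum_range_succ', h0]
      push_cast
      ring
    · rw [sum_range_succ_mul_pow, norm_add_mul_sq, Complex.add_re, Complex.add_re,
        Complex.ofReal_re]
      have h1 := hle w hw
      have h2 : ‖w‖ ^ 2 ≤ 1 := pow_le_one₀ (norm_nonneg w) hw.le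
      -- The only loss is $|w|^2|q|^2\le|q|^2$, so equality would hold on the unit circle.
      nlinarith [sq_nonneg ‖∑ n ∈ Finset.range N, a (n + 1) * w ^ n‖]

/-- **Harnack's inequality** for the real part of a holomorphic function on the unit disc. -/
theorem re_le_of_re_nonneg {h : ℂ → ℂ} (hd : DifferentiableOn ℂ h (ball 0 1))
    (hh : ∀ w : ℂ, ‖w‖ < 1 → 0 ≤ (h w).re) {w : ℂ} (hw : ‖w‖ < 1) :
    (h w).re ≤ (1 + ‖w‖) / (1 - ‖w‖) * ‖h 0‖ := by
  have hpos : 0 < 1 - ‖w‖ := by linarith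
  have key : ∀ ε > 0, (h w).re ≤ 2 * ε * ‖w‖ / (1 - ‖w‖) + ‖h 0‖ * (1 + ‖w‖) / (1 - ‖w‖) := by
    intro ε hε
    -- Borel–Carathéodory for $-h$ on the unit disc. The hypothesis gives
    -- $\operatorname{Re}(-h)\le0$, but the bound has to be a positive number, hence $\varepsilon$,
    -- which tends to $0^+$ afterwards.
    have := Complex.borelCaratheodory (f := fun z => -h z) hε hd.neg
      (fun z hz => by
        have := hh z (by simpa using hz)
        simp only [Set.mem_ofPred_eq, Complex.neg_re]
        linarith) one_pos (z := w) (by simpa using hw)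
    simp only [norm_neg] at this
    exact (Complex.re_le_norm _).trans this
  have hlim : Tendsto (fun ε : ℝ => 2 * ε * ‖w‖ / (1 - ‖w‖) + ‖h 0‖ * (1 + ‖w‖) / (1 - ‖w‖))
      (𝓝[>] 0) (𝓝 (‖h 0‖ * (1 + ‖w‖) / (1 - ‖w‖))) := by
    have : Continuous fun ε : ℝ =>
        2 * ε * ‖w‖ / (1 - ‖w‖) + ‖h 0‖ * (1 + ‖w‖) / (1 - ‖w‖) := by fun_prop
    simpa using (this.tendsto 0).mono_left nhdsWithin_le_nhds
  have := ge_of_tendsto hlim (eventually_nhdsWithin_of_forall fun ε hε => key ε hε)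
  rwa [div_mul_eq_mul_div, mul_comm]

theorem circleAverage_re_of_differentiableOn {h : ℂ → ℂ} {r : ℝ} (hr : 0 ≤ r) (hr1 : r < 1)
    (hd : DifferentiableOn ℂ h (ball 0 1)) :
    circleAverage (fun z => (h z).re) 0 r = (h 0).re := by
  have hsub : closedBall (0 : ℂ) r ⊆ ball 0 1 := closedBall_subset_ball hr1
  have hci : CircleIntegrable h 0 r :=
    ((hd.continuousOn.mono hsub).mono sphere_subset_closedBall).circleIntegrable hr
  have h1 := Complex.reCLM.circleAverage_comp_comm hci
  have h2 : circleAverage h 0 r = h 0 := by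
    refine DiffContOnCl.circleAverage (hd.mono ?_).diffContOnCl
    rw [abs_of_nonneg hr]
    exact closure_ball_subset_closedBall.trans hsub
  rw [h2] at h1
  exact h1

/-- Parseval's identity for polynomials on a circle. -/
theorem circleAverage_norm_sq_sum_range {r : ℝ} (hr : 0 ≤ r) (hr1 : r < 1) (N : ℕ) (a : ℕ → ℂ) :
    circleAverage (fun z => ‖∑ n ∈ Finset.range N, a n * z ^ n‖ ^ 2) 0 r =
      ∑ n ∈ Finset.range N, ‖a n‖ ^ 2 * (r ^ 2) ^ n := by
  induction N generalizing a with
  | zero => simp [circleAverage_const]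
  | succ N ih =>
    have hq := differentiable_sum_range_mul_pow (fun n => a (n + 1)) N
    set q : ℂ → ℂ := fun w => ∑ n ∈ Finset.range N, a (n + 1) * w ^ n with hqdef
    -- On the circle the factor $|z|^2$ is the constant $r^2$; the other terms are the real part of
    -- a holomorphic function and average to $|a_0|^2$.
    have e : Set.EqOn (fun z => ‖∑ n ∈ Finset.range (N + 1), a n * z ^ n‖ ^ 2)
        (fun z => (((‖a 0‖ ^ 2 : ℝ) : ℂ) + 2 * (starRingEnd ℂ (a 0) * (z * q z))).re +
          r ^ 2 * ‖q z‖ ^ 2) (sphere 0 |r|) := by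
      intro z hz
      have hz' : ‖z‖ = r := by simpa [abs_of_nonneg hr] using hz
      simp only
      rw [sum_range_succ_mul_pow, norm_add_mul_sq, Complex.add_re, Complex.ofReal_re, hz']
    have hc1 : Continuous fun z =>
        (((‖a 0‖ ^ 2 : ℝ) : ℂ) + 2 * (starRingEnd ℂ (a 0) * (z * q z))).re := by
      have := hq.continuous
      exact Complex.continuous_re.comp (by fun_prop)
    have hc2 : Continuous fun z => r ^ 2 * ‖q z‖ ^ 2 := by
      have := hq.continuous
      fun_prop
    rw [circleAverage_congr_sphere e, circleAverage_fun_add hc1.continuousOn.circleIntegrable'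
      hc2.continuousOn.circleIntegrable',
      circleAverage_re_of_differentiableOn (h := fun z => ((‖a 0‖ ^ 2 : ℝ) : ℂ) +
        2 * (starRingEnd ℂ (a 0) * (z * q z))) hr hr1 (by fun_prop)]
    have := circleAverage_fun_smul (𝕜 := ℝ) (a := r ^ 2) (f := fun z => ‖q z‖ ^ 2) (c := 0) (R := r)
    simp only [smul_eq_mul] at this
    rw [this, ih fun n => a (n + 1), Finset.sum_range_succ']
    simp only [zero_mul, mul_zero, add_zero, pow_zero, mul_one, Complex.ofReal_re]
    rw [add_comm, Finset.mul_sum]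
    congr 1
    exact Finset.sum_congr rfl fun n _ => by ring

/-- Circle averages of the squared moduli of the partial sums of a power series, composed with a
continuous map into the unit disc, converge. -/
theorem tendsto_circleAverage_norm_sq_sum_range {a : ℕ → ℂ} {f ψ : ℂ → ℂ} {r : ℝ}
    (hf : ∀ z : ℂ, ‖z‖ < 1 → HasSum (fun n => a n * z ^ n) (f z)) (hr : 0 ≤ r)
    (hψ : ContinuousOn ψ (sphere 0 r)) (hψ1 : ∀ z ∈ sphere (0 : ℂ) r, ‖ψ z‖ < 1) :
    Tendsto (fun N => circleAverage (fun z => ‖∑ n ∈ Finset.range N, a n * ψ z ^ n‖ ^ 2) 0 r)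
      atTop (𝓝 (circleAverage (fun z => ‖f (ψ z)‖ ^ 2) 0 r)) := by
  -- By compactness $|\psi|$ peaks on the circle at some $z_0$ with $|\psi(z_0)|<1$. The power
  -- series converges absolutely there, which gives a constant dominating all partial sums.
  obtain ⟨z₀, hz₀, hmax⟩ := (isCompact_sphere (0 : ℂ) r).exists_isMaxOn
    (NormedSpace.sphere_nonempty.2 hr) hψ.norm
  have hs : Summable fun n => ‖a n‖ * ‖ψ z₀‖ ^ n := by
    simpa using (hf _ (hψ1 z₀ hz₀)).summable.norm
  have hmem : ∀ θ, circleMap 0 r θ ∈ sphere (0 : ℂ) r := fun θ => circleMap_mem_sphere 0 hr θ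
  have hcont : Continuous fun θ => ψ (circleMap 0 r θ) :=
    hψ.comp_continuous (continuous_circleMap 0 r) hmem
  simp only [circleAverage_def]
  refine Tendsto.const_smul (intervalIntegral.tendsto_integral_filter_of_dominated_convergence
    (fun _ => (∑' n, ‖a n‖ * ‖ψ z₀‖ ^ n) ^ 2) ?_ ?_ ?_ ?_) _
  · exact Eventually.of_forall fun N => Continuous.aestronglyMeasurable
      ((continuous_finsetSum _ fun n _ => continuous_const.mul (hcont.pow n)).norm.pow 2)
  · refine Eventually.of_forall fun N => Eventually.of_forall fun θ _ => ?_
    rw [Real.norm_eq_abs, abs_of_nonneg (by positivity)]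
    gcongr
    refine (norm_sum_le _ _).trans (le_trans (Finset.sum_le_sum fun n _ => ?_)
      (hs.sum_le_tsum (Finset.range N) fun n _ => by positivity))
    rw [norm_mul, norm_pow]
    gcongr
    exact hmax (hmem θ)
  · exact intervalIntegrable_const
  · refine Eventually.of_forall fun θ _ => ?_
    exact ((hf _ (hψ1 _ (hmem θ))).tendsto_sum_nat.norm).pow 2

/-- **Littlewood's subordination theorem** on the Hardy space of the unit disc. -/
theorem littlewood_complex {a : ℕ → ℂ} {f φ : ℂ → ℂ} (hfd : DifferentiableOn ℂ f (ball 0 1))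
    (hf : ∀ z : ℂ, ‖z‖ < 1 → HasSum (fun n => a n * z ^ n) (f z))
    (ha : Summable fun n => ‖a n‖ ^ 2) (hφ : DifferentiableOn ℂ φ (ball 0 1))
    (hφ1 : ∀ z : ℂ, ‖z‖ < 1 → ‖φ z‖ < 1) :
    ∃ b : ℕ → ℂ, (∀ z : ℂ, ‖z‖ < 1 → HasSum (fun n => b n * z ^ n) (f (φ z))) ∧
      (Summable fun n => ‖b n‖ ^ 2) ∧
      ∑' n, ‖b n‖ ^ 2 ≤ (1 + ‖φ 0‖) / (1 - ‖φ 0‖) * ∑' n, ‖a n‖ ^ 2 := by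
  have hmaps : Set.MapsTo φ (ball 0 1) (ball 0 1) := fun z hz => by
    simpa using hφ1 z (by simpa using hz)
  have hφ0 : ‖φ 0‖ < 1 := hφ1 0 (by simp)
  have hC : 0 ≤ (1 + ‖φ 0‖) / (1 - ‖φ 0‖) := div_nonneg (by positivity) (by linarith)
  have hg : DifferentiableOn ℂ (fun z => f (φ z)) (ball 0 1) := hfd.comp hφ hmaps
  set b : ℕ → ℂ := fun n => (n.factorial : ℂ)⁻¹ * iteratedDeriv n (fun z => f (φ z)) 0 with hb
  have hbs : ∀ z : ℂ, ‖z‖ < 1 → HasSum (fun n => b n * z ^ n) (f (φ z)) := by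
    intro z hz
    refine (Complex.hasSum_taylorSeries_on_ball hg (z := z) (by simpa using hz)).congr_fun
      fun n => ?_
    simp only [hb, sub_zero, smul_eq_mul]
    ring
  have hsub : ∀ r < (1 : ℝ), sphere (0 : ℂ) r ⊆ ball 0 1 := fun r hr =>
    sphere_subset_closedBall.trans (closedBall_subset_ball hr)
  have hmean : ∀ r : ℝ, 0 ≤ r → r < 1 → circleAverage (fun z => ‖f (φ z)‖ ^ 2) 0 r ≤
      (1 + ‖φ 0‖) / (1 - ‖φ 0‖) * ∑' n, ‖a n‖ ^ 2 := by
    intro r hr hr1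
    have hφc : ContinuousOn φ (sphere 0 r) := hφ.continuousOn.mono (hsub r hr1)
    refine le_of_tendsto (tendsto_circleAverage_norm_sq_sum_range hf hr hφc
      fun z hz => hφ1 z (by simpa using hsub r hr1 hz)) (Eventually.of_forall fun N => ?_)
    -- The majorant belongs to the $N$-th partial sum of $f$; its value at $0$ stays below
    -- $\sum|a_n|^2$ uniformly in $N$.
    obtain ⟨h, hd, h0, hle⟩ := exists_re_majorant_norm_sq N a
    have hhφ : DifferentiableOn ℂ (fun z => h (φ z)) (ball 0 1) :=
      hd.differentiableOn.comp hφ hmaps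
    have hsum : 0 ≤ ∑ n ∈ Finset.range N, ‖a n‖ ^ 2 := by positivity
    calc circleAverage (fun z => ‖∑ n ∈ Finset.range N, a n * φ z ^ n‖ ^ 2) 0 r
        ≤ circleAverage (fun z => (h (φ z)).re) 0 r := by
          refine circleAverage_mono (ContinuousOn.circleIntegrable hr (by fun_prop))
            (ContinuousOn.circleIntegrable hr ?_) fun z hz => ?_
          · exact Complex.continuous_re.comp_continuousOn (hhφ.continuousOn.mono (hsub r hr1))
          · rw [abs_of_nonneg hr] at hz
            exact hle _ (hφ1 z (by simpa using hsub r hr1 hz))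
      _ = (h (φ 0)).re := circleAverage_re_of_differentiableOn hr hr1 hhφ
      _ ≤ (1 + ‖φ 0‖) / (1 - ‖φ 0‖) * ‖h 0‖ :=
          re_le_of_re_nonneg hd.differentiableOn
            (fun w hw => (sq_nonneg _).trans (hle w hw)) hφ0
      _ ≤ (1 + ‖φ 0‖) / (1 - ‖φ 0‖) * ∑' n, ‖a n‖ ^ 2 := by
          gcongr
          rw [h0, Complex.norm_real, Real.norm_of_nonneg hsum]
          exact ha.sum_le_tsum _ fun n _ => by positivity
  have hpart : ∀ r : ℝ, 0 ≤ r → r < 1 → ∀ N, ∑ n ∈ Finset.range N, ‖b n‖ ^ 2 * (r ^ 2) ^ n ≤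
      (1 + ‖φ 0‖) / (1 - ‖φ 0‖) * ∑' n, ‖a n‖ ^ 2 := by
    intro r hr hr1 N
    -- The same convergence lemma, now for the Taylor series of $f\circ\varphi$ itself, hence
    -- $\psi=\mathrm{id}$. The Parseval sums increase to the mean, so each of them is bounded by it.
    have ht := tendsto_circleAverage_norm_sq_sum_range (f := fun z => f (φ z)) (ψ := id) hbs hr
      continuousOn_id fun z hz => by simpa using hsub r hr1 hz
    simp only [id, circleAverage_norm_sq_sum_range hr hr1] at ht
    have hmono : Monotone fun N => ∑ n ∈ Finset.range N, ‖b n‖ ^ 2 * (r ^ 2) ^ n :=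
      monotone_nat_of_le_succ fun N => by
        rw [Finset.sum_range_succ]
        exact le_add_of_nonneg_right (by positivity)
    exact (hmono.ge_of_tendsto ht N).trans (hmean r hr hr1)
  have hbound : ∀ N, ∑ n ∈ Finset.range N, ‖b n‖ ^ 2 ≤
      (1 + ‖φ 0‖) / (1 - ‖φ 0‖) * ∑' n, ‖a n‖ ^ 2 := by
    intro N
    have hcont : Continuous fun r : ℝ => ∑ n ∈ Finset.range N, ‖b n‖ ^ 2 * (r ^ 2) ^ n := by
      fun_prop
    -- $N$ is fixed while $r\to1^-$, so this limit is just continuity of a polynomial in $r$.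
    have ht := (hcont.tendsto 1).mono_left (nhdsWithin_le_nhds (s := Set.Iio 1))
    simp only [one_pow, mul_one] at ht
    refine le_of_tendsto ht ?_
    filter_upwards [Ioo_mem_nhdsLT (zero_lt_one (α := ℝ))] with r hr
    exact hpart r hr.1.le hr.2 N
  exact ⟨b, hbs, summable_of_sum_range_le (fun n => by positivity) hbound,
    Real.tsum_le_of_sum_range_le (fun n => by positivity) hbound⟩

end ComplexLittlewood

/-! ### Reduction of the bicomplex statement to its idempotent components -/

namespace Bicomplex

open Metric

theorem continuous_ofComplex : Continuous ofComplex :=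
  continuous_induced_rng.2 (continuous_id.prodMk continuous_const)

/-- The idempotent representation rebuilds $Z$ from its components by continuous additive maps, so
componentwise convergence suffices. -/
theorem hasSum_of_idem {g : ℕ → Bicomplex} {s : Bicomplex}
    (h₁ : HasSum (fun n => (g n).idem₁) s.idem₁) (h₂ : HasSum (fun n => (g n).idem₂) s.idem₂) :
    HasSum g s := by
  let ι : ℂ →+ Bicomplex :=
    { toFun := ofComplex
      map_zero' := rfl
      map_add' := fun a b => by ext <;> simp [ofComplex] }
  have k := ((h₁.map ι continuous_ofComplex).mul_right e₁).add
    ((h₂.map ι continuous_ofComplex).mul_right e₂)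
  have e : ι s.idem₁ * e₁ + ι s.idem₂ * e₂ = s := (idempotent_representation s).symm
  rw [e] at k
  exact k.congr_fun fun n => idempotent_representation (g n)

theorem hasSum_iff_idem {g : ℕ → Bicomplex} {s : Bicomplex} :
    HasSum g s ↔ HasSum (fun n => (g n).idem₁) s.idem₁ ∧ HasSum (fun n => (g n).idem₂) s.idem₂ :=
  ⟨fun h => ⟨h.map idemHom₁ continuous_idem₁, h.map idemHom₂ continuous_idem₂⟩,
    fun h => hasSum_of_idem h.1 h.2⟩

theorem combo_mem_unitDiscus {z w : ℂ} (hz : ‖z‖ < 1) (hw : ‖w‖ < 1) :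
    ofComplex z * e₁ + ofComplex w * e₂ ∈ unitDiscus :=
  ⟨by rwa [idem₁_combo], by rwa [idem₂_combo]⟩

theorem image_idem₁_unitDiscus : idem₁ '' unitDiscus = ball 0 1 := by
  ext z
  simp only [Set.mem_image, mem_ball_zero_iff]
  exact ⟨fun ⟨Z, hZ, h⟩ => h ▸ hZ.1,
    fun hz => ⟨_, combo_mem_unitDiscus hz hz, idem₁_combo z z⟩⟩

theorem image_idem₂_unitDiscus : idem₂ '' unitDiscus = ball 0 1 := by
  ext z
  simp only [Set.mem_image, mem_ball_zero_iff]
  exact ⟨fun ⟨Z, hZ, h⟩ => h ▸ hZ.2,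
    fun hz => ⟨_, combo_mem_unitDiscus hz hz, idem₂_combo z z⟩⟩

end Bicomplex

/-! ### Idempotent components of hyperbolic series, square roots and quotients -/

namespace Hyperbolic

theorem continuous_idem₁ : Continuous idem₁ :=
  have h : Continuous fun a : Hyperbolic => (a.x, a.y) := continuous_induced_dom
  (continuous_fst.comp h).add (continuous_snd.comp h)

theorem continuous_idem₂ : Continuous idem₂ :=
  have h : Continuous fun a : Hyperbolic => (a.x, a.y) := continuous_induced_dom
  (continuous_fst.comp h).sub (continuous_snd.comp h)

theorem idem₁_tsum {g : ℕ → Hyperbolic} (hg : Summable g) :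
    (∑' n, g n).idem₁ = ∑' n, (g n).idem₁ := by
  let ι : Hyperbolic →+ ℝ :=
    { toFun := idem₁, map_zero' := by simp [idem₁], map_add' := idem₁_add }
  exact (hg.hasSum.map ι continuous_idem₁).tsum_eq.symm

theorem idem₂_tsum {g : ℕ → Hyperbolic} (hg : Summable g) :
    (∑' n, g n).idem₂ = ∑' n, (g n).idem₂ := by
  let ι : Hyperbolic →+ ℝ :=
    { toFun := idem₂, map_zero' := by simp [idem₂], map_add' := idem₂_add }
  exact (hg.hasSum.map ι continuous_idem₂).tsum_eq.symm

@[simp] theorem idem₁_sqrt (a : Hyperbolic) : (sqrt a).idem₁ = √a.idem₁ := idem₁_ofIdem _ _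
@[simp] theorem idem₂_sqrt (a : Hyperbolic) : (sqrt a).idem₂ = √a.idem₂ := idem₂_ofIdem _ _

theorem idem₁_div (a b : Hyperbolic) : (a / b).idem₁ = a.idem₁ / b.idem₁ := idem₁_ofIdem _ _
theorem idem₂_div (a b : Hyperbolic) : (a / b).idem₂ = a.idem₂ / b.idem₂ := idem₂_ofIdem _ _

theorem idem₁_sub (a b : Hyperbolic) : (a - b).idem₁ = a.idem₁ - b.idem₁ := by
  simp [idem₁]; ring
theorem idem₂_sub (a b : Hyperbolic) : (a - b).idem₂ = a.idem₂ - b.idem₂ := by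
  simp [idem₂]; ring

@[simp] theorem idem₁_zero : (0 : Hyperbolic).idem₁ = 0 := by simp [idem₁]
@[simp] theorem idem₂_zero : (0 : Hyperbolic).idem₂ = 0 := by simp [idem₂]
@[simp] theorem idem₁_one : (1 : Hyperbolic).idem₁ = 1 := by simp [idem₁]
@[simp] theorem idem₂_one : (1 : Hyperbolic).idem₂ = 1 := by simp [idem₂]

end Hyperbolic

/-! ### Littlewood's inequality for the hyperbolic-valued Hardy norm -/

section HardyNorm

open Bicomplex Metric

theorem idem₁_tsum_hypAbs_sq {a : ℕ → Bicomplex} (ha : Summable fun n => (a n).hypAbs ^ 2) :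
    (∑' n, (a n).hypAbs ^ 2).idem₁ = ∑' n, ‖(a n).idem₁‖ ^ 2 := by
  rw [Hyperbolic.idem₁_tsum ha]
  simp [hypAbs, sq, Hyperbolic.idem₁_mul]

theorem idem₂_tsum_hypAbs_sq {a : ℕ → Bicomplex} (ha : Summable fun n => (a n).hypAbs ^ 2) :
    (∑' n, (a n).hypAbs ^ 2).idem₂ = ∑' n, ‖(a n).idem₂‖ ^ 2 := by
  rw [Hyperbolic.idem₂_tsum ha]
  simp [hypAbs, sq, Hyperbolic.idem₂_mul]

/-- The bound in Littlewood's theorem. -/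
noncomputable def littlewoodBound (Φ : unitDiscus → unitDiscus) : Hyperbolic :=
  Hyperbolic.sqrt ((1 + (Φ 0 : Bicomplex).hypAbs) / (1 - (Φ 0 : Bicomplex).hypAbs))

theorem idem₁_littlewoodBound (Φ : unitDiscus → unitDiscus) : (littlewoodBound Φ).idem₁ =
    √((1 + ‖(Φ 0 : Bicomplex).idem₁‖) / (1 - ‖(Φ 0 : Bicomplex).idem₁‖)) := by
  simp [littlewoodBound, Hyperbolic.idem₁_div, Hyperbolic.idem₁_add, Hyperbolic.idem₁_sub, hypAbs]

theorem idem₂_littlewoodBound (Φ : unitDiscus → unitDiscus) : (littlewoodBound Φ).idem₂ =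
    √((1 + ‖(Φ 0 : Bicomplex).idem₂‖) / (1 - ‖(Φ 0 : Bicomplex).idem₂‖)) := by
  simp [littlewoodBound, Hyperbolic.idem₂_div, Hyperbolic.idem₂_add, Hyperbolic.idem₂_sub, hypAbs]

theorem littlewoodBound_nonneg (Φ : unitDiscus → unitDiscus) : 0 ≤ littlewoodBound Φ := by
  rw [Hyperbolic.le_def, idem₁_littlewoodBound, idem₂_littlewoodBound]
  simp

/-- Composition with a holomorphic self-map of the unit discus preserves the Hardy space and
satisfies Littlewood's bound on the level of coefficients. -/
theorem exists_coeff_comp {Φ : unitDiscus → unitDiscus}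
    (hΦ : BicomplexHolomorphic (fun Z => (Φ Z : Bicomplex))) {f : unitDiscus → Bicomplex}
    (hf : BicomplexHolomorphic f) {a : ℕ → Bicomplex} (ha : HasBicomplexPowerSeries f a)
    (hs : Summable fun n => (a n).hypAbs ^ 2) :
    BicomplexHolomorphic (f ∘ Φ) ∧ ∃ b, HasBicomplexPowerSeries (f ∘ Φ) b ∧
      (Summable fun n => (b n).hypAbs ^ 2) ∧
      Hyperbolic.sqrt (∑' n, (b n).hypAbs ^ 2) ≤
        littlewoodBound Φ * Hyperbolic.sqrt (∑' n, (a n).hypAbs ^ 2) := by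
  obtain ⟨G₁, G₂, hG₁, hG₂, hG⟩ := hΦ
  obtain ⟨F₁, F₂, hF₁, hF₂, hF⟩ := hf
  beta_reduce at hG
  rw [image_idem₁_unitDiscus] at hG₁ hF₁
  rw [image_idem₂_unitDiscus] at hG₂ hF₂
  have hΦ₁ : ∀ Z : unitDiscus, (Φ Z : Bicomplex).idem₁ = G₁ (Z : Bicomplex).idem₁ := fun Z => by
    rw [hG Z, idem₁_combo]
  have hΦ₂ : ∀ Z : unitDiscus, (Φ Z : Bicomplex).idem₂ = G₂ (Z : Bicomplex).idem₂ := fun Z => by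
    rw [hG Z, idem₂_combo]
  have hf₁ : ∀ Z : unitDiscus, (f Z).idem₁ = F₁ (Z : Bicomplex).idem₁ := fun Z => by
    rw [hF Z, idem₁_combo]
  have hf₂ : ∀ Z : unitDiscus, (f Z).idem₂ = F₂ (Z : Bicomplex).idem₂ := fun Z => by
    rw [hF Z, idem₂_combo]
  have hG₁m : ∀ z : ℂ, ‖z‖ < 1 → ‖G₁ z‖ < 1 := fun z hz => by
    -- The diagonal point $ze_1+ze_2$ lies in the discus and has both components equal to $z$, so it
    -- tests a one-variable component of $\Phi$ at $z$.
    have h := (Φ ⟨_, combo_mem_unitDiscus hz hz⟩).2.1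
    rwa [hΦ₁, idem₁_combo] at h
  have hG₂m : ∀ z : ℂ, ‖z‖ < 1 → ‖G₂ z‖ < 1 := fun z hz => by
    have h := (Φ ⟨_, combo_mem_unitDiscus hz hz⟩).2.2
    rwa [hΦ₂, idem₂_combo] at h
  have ha₁ : ∀ z : ℂ, ‖z‖ < 1 → HasSum (fun n => (a n).idem₁ * z ^ n) (F₁ z) := fun z hz => by
    have h := (hasSum_iff_idem.1 (ha ⟨_, combo_mem_unitDiscus hz hz⟩)).1
    simpa only [hf₁, idem₁_mul, idem₁_pow, idem₁_combo] using h
  have ha₂ : ∀ z : ℂ, ‖z‖ < 1 → HasSum (fun n => (a n).idem₂ * z ^ n) (F₂ z) := fun z hz => by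
    have h := (hasSum_iff_idem.1 (ha ⟨_, combo_mem_unitDiscus hz hz⟩)).2
    simpa only [hf₂, idem₂_mul, idem₂_pow, idem₂_combo] using h
  have hs' := (summable_hypAbs_sq_iff a).1 hs
  obtain ⟨b₁, hb₁, hbs₁, hle₁⟩ := littlewood_complex hF₁ ha₁ hs'.1 hG₁ hG₁m
  obtain ⟨b₂, hb₂, hbs₂, hle₂⟩ := littlewood_complex hF₂ ha₂ hs'.2 hG₂ hG₂m
  have hbs : Summable fun n => (ofComplex (b₁ n) * e₁ + ofComplex (b₂ n) * e₂).hypAbs ^ 2 := by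
    rw [summable_hypAbs_sq_iff]
    simpa only [idem₁_combo, idem₂_combo] using ⟨hbs₁, hbs₂⟩
  refine ⟨⟨F₁ ∘ G₁, F₂ ∘ G₂, ?_, ?_, fun Z => ?_⟩,
    fun n => ofComplex (b₁ n) * e₁ + ofComplex (b₂ n) * e₂, fun Z => ?_, hbs, ?_⟩
  · rw [image_idem₁_unitDiscus]
    exact hF₁.comp hG₁ fun z hz => by simpa using hG₁m z (by simpa using hz)
  · rw [image_idem₂_unitDiscus]
    exact hF₂.comp hG₂ fun z hz => by simpa using hG₂m z (by simpa using hz)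
  · rw [Function.comp_apply, hF, hΦ₁, hΦ₂]
    rfl
  · refine hasSum_of_idem ?_ ?_
    · simpa only [Function.comp_apply, hf₁, hΦ₁, idem₁_mul, idem₁_pow, idem₁_combo]
        using hb₁ _ Z.2.1
    · simpa only [Function.comp_apply, hf₂, hΦ₂, idem₂_mul, idem₂_pow, idem₂_combo]
        using hb₂ _ Z.2.2
  · have z₁ : ((0 : unitDiscus) : Bicomplex).idem₁ = 0 := idem₁_zero
    have z₂ : ((0 : unitDiscus) : Bicomplex).idem₂ = 0 := idem₂_zero
    -- Strict inequality at $0$ keeps the denominators $1-|G_i(0)|$ positive, as needed to merge the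
    -- square roots into one.
    have n₁ := hG₁m 0 (by simp)
    have n₂ := hG₂m 0 (by simp)
    refine ⟨?_, ?_⟩
    · rw [Hyperbolic.idem₁_mul, idem₁_littlewoodBound, Hyperbolic.idem₁_sqrt, Hyperbolic.idem₁_sqrt,
        idem₁_tsum_hypAbs_sq hs, idem₁_tsum_hypAbs_sq hbs, hΦ₁, z₁,
        ← Real.sqrt_mul (div_nonneg (by positivity) (by linarith))]
      simp only [idem₁_combo]
      exact Real.sqrt_le_sqrt hle₁
    · rw [Hyperbolic.idem₂_mul, idem₂_littlewoodBound, Hyperbolic.idem₂_sqrt, Hyperbolic.idem₂_sqrt,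
        idem₂_tsum_hypAbs_sq hs, idem₂_tsum_hypAbs_sq hbs, hΦ₂, z₂,
        ← Real.sqrt_mul (div_nonneg (by positivity) (by linarith))]
      simp only [idem₂_combo]
      exact Real.sqrt_le_sqrt hle₂

theorem compositionOperator_mem_hardySpace {Φ : unitDiscus → unitDiscus}
    (hΦ : BicomplexHolomorphic (fun Z => (Φ Z : Bicomplex))) :
    ∀ f ∈ hardySpace, compositionOperator Φ f ∈ hardySpace := by
  rintro f ⟨hf, a, ha, hs⟩
  obtain ⟨h, b, hb, hbs, -⟩ := exists_coeff_comp hΦ hf ha hs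
  exact ⟨h, b, hb, hbs⟩

/-- The norm is defined through chosen coefficients; uniqueness of the power series
(`HasBicomplexPowerSeries.coeff_eq`) identifies them with those produced by `exists_coeff_comp`. -/
theorem hardyNorm_compositionOperator_le {Φ : unitDiscus → unitDiscus}
    (hΦ : BicomplexHolomorphic (fun Z => (Φ Z : Bicomplex))) (f : hardySpace) :
    hardyNorm ((compositionOperator Φ).restrict (compositionOperator_mem_hardySpace hΦ) f) ≤
      littlewoodBound Φ * hardyNorm f := by
  obtain ⟨f, hf, a, ha, hs⟩ := f
  obtain ⟨h, b, hb, hbs, hle⟩ := exists_coeff_comp hΦ hf ha hs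
  have h₁ : bicomplexCoeff (compositionOperator Φ f) = b := hb.coeff_eq
  simp only [hardyNorm, LinearMap.restrict_apply, h₁, ha.coeff_eq]
  exact hle

end HardyNorm

theorem theorem5p5 (Φ : unitDiscus → unitDiscus)
    (hΦ : BicomplexHolomorphic (fun Z => (Φ Z : Bicomplex))) :
    ∃ hmaps : ∀ f ∈ hardySpace, compositionOperator Φ f ∈ hardySpace,
      HardyBounded ((compositionOperator Φ).restrict hmaps) ∧
      IsLUB (hardyUnitBallNorms ((compositionOperator Φ).restrict hmaps))
        (hardyOpNorm ((compositionOperator Φ).restrict hmaps)) ∧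
      hardyOpNorm ((compositionOperator Φ).restrict hmaps) ≤
        Hyperbolic.sqrt ((1 + (Φ 0 : Bicomplex).hypAbs) / (1 - (Φ 0 : Bicomplex).hypAbs)) := by
  refine ⟨compositionOperator_mem_hardySpace hΦ, ?_⟩
  set T := (compositionOperator Φ).restrict (compositionOperator_mem_hardySpace hΦ)
  have hT : ∀ f, hardyNorm (T f) ≤ littlewoodBound Φ * hardyNorm f :=
    hardyNorm_compositionOperator_le hΦ
  have hub : littlewoodBound Φ ∈ upperBounds (hardyUnitBallNorms T) := by
    rintro _ ⟨f, hf, rfl⟩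
    have hM := littlewoodBound_nonneg Φ
    refine (hT f).trans ?_
    rw [Hyperbolic.le_def] at hf hM ⊢
    rw [Hyperbolic.idem₁_mul, Hyperbolic.idem₂_mul]
    simp only [Hyperbolic.idem₁_zero, Hyperbolic.idem₂_zero, Hyperbolic.idem₁_one,
      Hyperbolic.idem₂_one] at hM hf
    exact ⟨mul_le_of_le_one_right hM.1 hf.1, mul_le_of_le_one_right hM.2 hf.2⟩
  -- A componentwise supremum is a least upper bound only for a nonempty bounded set; the zero
  -- function supplies an element.
  have hne : (hardyUnitBallNorms T).Nonempty := by
    have h0 : HasBicomplexPowerSeries ((0 : hardySpace) : unitDiscus → Bicomplex) 0 := fun Z => by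
      simp
    have hc : bicomplexCoeff ((0 : hardySpace) : unitDiscus → Bicomplex) = 0 := h0.coeff_eq
    refine ⟨_, 0, ?_, rfl⟩
    have hs : Summable fun n => ((0 : ℕ → Bicomplex) n).hypAbs ^ 2 := by
      rw [summable_hypAbs_sq_iff]
      simp
    rw [hardyNorm, hc, Hyperbolic.le_def, Hyperbolic.idem₁_sqrt, Hyperbolic.idem₂_sqrt,
      idem₁_tsum_hypAbs_sq hs, idem₂_tsum_hypAbs_sq hs]
    simp
  have hlub := Hyperbolic.isLUB_sSup hne ⟨_, hub⟩
  exact ⟨⟨_, littlewoodBound_nonneg Φ, hT⟩, hlub, hlub.2 hub⟩
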